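/- Let $s\ge 0$ be an integer, let $p_0,\dots,p_{2s+1}:\mathbb R\to\mathbb R$ be $C^1$, and put $\psi=p_0$, $\varphi(x,y)=\sum_{k=1}^{2s+1}p_k(x)y^{k-1}$. Assume that $\varphi,\psi$ satisfy the Levinson--Smith conditions $C_{LS}$: $x\psi(x)>0$ for $x\ne0$; $\int_0^x\psi(r)\,dr\to+\infty$ as $x\to+\infty$; $\varphi(0,0)<0$; and there are numbers $0<x_0<x_1$ and $M>0$ such that $\varphi(x,y)\ge0$ for $|x|\ge x_0$, $\varphi(x,y)\ge -M$ for $|x|\le x_0$, and $\int_{x_0}^{x_1}\varphi(x,y(x))\,dx\ge 10Mx_0$ for every decreasing function $y(x)>0$. Let $\omega:\mathbb R^3\to\mathbb R$ be $C^1$ and $1$-periodic in its first variable. Let $u_0$ be a non-constant periodic solution of $$u''+\sum_{k=0}^{2s+1}p_k(u)u'^k=0$$ with least positive period $\tau_0$, the origin of time being chosen so that $u_0(0)=a<0$ and $u_0'(0)=0$. Let $\Phi$, $\Phi(0)=\mathrm{Id}$, be the fundamental matrix of the variational system $y'=f'(q(t))y$ of the equivalent plane system $x'=f(x)=\bigl(-\sum_{k=0}^{2s+1}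 p_k(x_2)x_1^k,\;x_1\bigr)$, with $x=(x_1,x_2)=(u',u)$, along $q=(u_0',u_0)$. The characteristic multipliers are the eigenvalues of $\Phi(\tau_0)$, counted with algebraic multiplicity. Suppose that $1$ is a simple characteristic multiplier. Then the characteristic multipliers are $1$ and $$\rho_2=\exp\Bigl(-\int_0^{\tau_0}\sum_{k=1}^{2s+1}k\,p_k(u_0(t))\,u_0'(t)^{k-1}\,dt\Bigr),$$ and there are an open set $U\subset\mathbb R^2$ containing $(0,0)$, $C^1$ functions $\tau,h:U\to\mathbb R$ and a constant $0<\tau_1<\tau_0$ such that $\tau(0,0)=\tau_0$, $h(0,0)=0$ and, for every $(\varepsilon,\alpha)\in U$, one has $|\tau(\varepsilon,\alpha)-\tau_0|<\tau_1$ and the solution $\nu$ of $$u''+\sum_{k=0}^{2s+1}p_k(u)u'^k=\varepsilon\,\omega\Bigl(\frac{t}{\tau(\varepsilon,\alpha)},u,u'\Bigr),\qquad \nu(\alpha)=a+h(\varepsilon,\alpha),\quad \nu'(\alpha)=0,$$ exists on all of $\mathbb R$ and is periodic with period $\tau(\varepsilon,\alpha)$. -/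

import Mathlib

open Filter Finset

noncomputable section

namespace Lienard

/-- The Levinson-Smith conditions on the pair `φ, ψ`. A decreasing positive function `y` is only
evaluated on `[x₀, x₁]`, so monotonicity and positivity are only required there. -/
def LevinsonSmith (φ : ℝ → ℝ → ℝ) (ψ : ℝ → ℝ) : Prop :=
  (∀ x : ℝ, 0 < |x| → 0 < x * ψ x) ∧
  Tendsto (fun x : ℝ => ∫ r in (0 : ℝ)..x, ψ r) atTop atTop ∧
  φ 0 0 < 0 ∧
  ∃ x₀ x₁ M : ℝ, 0 < x₀ ∧ x₀ < x₁ ∧ 0 < M ∧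
    (∀ x y : ℝ, x₀ ≤ |x| → 0 ≤ φ x y) ∧
    (∀ x y : ℝ, |x| ≤ x₀ → -M ≤ φ x y) ∧
    ∀ y : ℝ → ℝ, StrictAntiOn y (Set.Icc x₀ x₁) → (∀ x ∈ Set.Icc x₀ x₁, 0 < y x) →
      10 * M * x₀ ≤ ∫ x in x₀..x₁, φ x (y x)

/-- `φ(u, v) = ∑_{k=1}^{2s+1} p_k(u) v^(k-1)`. -/
def damping (s : ℕ) (p : ℕ → ℝ → ℝ) (u v : ℝ) : ℝ :=
  ∑ k ∈ Icc 1 (2 * s + 1), p k u * v ^ (k - 1)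

/-- `∑_{k=0}^{2s+1} p_k(u) v^k`. -/
def polyTerm (s : ℕ) (p : ℕ → ℝ → ℝ) (u v : ℝ) : ℝ :=
  ∑ k ∈ range (2 * s + 2), p k u * v ^ k

/-- `u` is a solution on the whole real line of `u'' + F(u, u') = g(t, u, u')`. -/
def IsSolution (F : ℝ → ℝ → ℝ) (g : ℝ → ℝ → ℝ → ℝ) (u : ℝ → ℝ) : Prop :=
  Differentiable ℝ u ∧
  ∀ t : ℝ, HasDerivAt (deriv u) (g t (u t) (deriv u t) - F (u t) (deriv u t)) t

/-- The vector field, in the variables `x = (x₁, x₂) = (u', u)`, of the plane system equivalent to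
`u'' + F(u, u') = 0`. -/
def planeField (F : ℝ → ℝ → ℝ) (x : ℝ × ℝ) : ℝ × ℝ := (-F x.2 x.1, x.1)

/-- `Φ` is the fundamental solution, normalised by `Φ(0) = id`, of the variational system
`y' = f'(q(t)) y` of `x' = f(x)` along `q`. -/
def IsFundamental (f : ℝ × ℝ → ℝ × ℝ) (q : ℝ → ℝ × ℝ)
    (Φ : ℝ → (ℝ × ℝ) →L[ℝ] (ℝ × ℝ)) : Prop :=
  Φ 0 = ContinuousLinearMap.id ℝ (ℝ × ℝ) ∧
  ∀ t : ℝ, HasDerivAt Φ ((fderiv ℝ f (q t)).comp (Φ t)) t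

/-- The characteristic polynomial of `Φ(T)`; its roots, with multiplicity, are the characteristic
multipliers of the variational system along a `T`-periodic orbit. -/
def multiplierPoly (Φ : ℝ → (ℝ × ℝ) →L[ℝ] (ℝ × ℝ)) (T : ℝ) : Polynomial ℝ :=
  LinearMap.charpoly ((Φ T : (ℝ × ℝ) →L[ℝ] (ℝ × ℝ)) : (ℝ × ℝ) →ₗ[ℝ] (ℝ × ℝ))

end Lienard

end

/-! Fix the phase and period by setting z(s) = (ν', ν)(α + τs). A τ-periodic solution becomes a
closed arc on [0,1] of z' = τ(f(z) + (ε ω(α/τ + s, z₂, z₁), 0)) with z(0) = (0, a + h). Written as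
an integral equation together with z(1) = z(0), this is a C¹ equation in the Banach space C([0,1],
ℝ²) × ℝ², with unknowns (z, h, τ) and parameters (ε, α). The implicit function theorem is applied at
the unforced orbit, so no flow or Poincaré map is needed.

The linearisation in the unknowns is (ζ, η, σ) ↦ (ζ - ∫Aζ - (0, η) - σ∫b, ζ(1) - ζ(0)). Variation of
constants inverts ζ - ∫Aζ (`linearVolterra_bijective`), which leaves a 2×2 system with columns
Φ(τ₀)e₂ - e₂ and f(q(0)). Since u₀'(0) = 0, the velocity f(q(0)) = -p₀(a)e₁ is a multiple of e₁, and
Φ(τ₀) fixes it. The system is therefore triangular, with diagonal entries det Φ(τ₀) - 1 and -p₀(a)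
up to order. The first is nonzero because 1 is a simple multiplier, the second by the sign condition
on ψ.

As 1 is a multiplier, the other one is det Φ(τ₀), which Liouville's formula evaluates. Closed arcs
extend to the whole line because ω is 1-periodic. -/

noncomputable section

namespace Lienard

/-! ### Differentiability of superposition operators on C(K, E). -/

section Superposition

variable {K E F : Type*} [TopologicalSpace K] [CompactSpace K]
  [NormedAddCommGroup E] [NormedSpace ℝ E] [NormedAddCommGroup F] [NormedSpace ℝ F]

/-- Pointwise application of a continuous family of operators to a continuous family of vectors. -/
def pointwiseApply (K E F : Type*) [TopologicalSpace K] [CompactSpace K]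
    [NormedAddCommGroup E] [NormedSpace ℝ E] [NormedAddCommGroup F] [NormedSpace ℝ F] :
    C(K, E →L[ℝ] F) →L[ℝ] C(K, E) →L[ℝ] C(K, F) :=
  LinearMap.mkContinuous₂
    (LinearMap.mk₂ ℝ (fun (B : C(K, E →L[ℝ] F)) (z : C(K, E)) =>
        (⟨fun s => B s (z s), B.continuous.clm_apply z.continuous⟩ : C(K, F)))
      (fun B C z => by ext s; simp) (fun c B z => by ext s; simp)
      (fun B z w => by ext s; simp) (fun c B z => by ext s; simp)) 1
    (fun B z => by
      rw [ContinuousMap.norm_le _ (by positivity)]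
      intro s
      rw [one_mul]
      exact (B s).le_of_opNorm_le_of_le (B.norm_coe_le_norm s) (z.norm_coe_le_norm s))

@[simp]
theorem pointwiseApply_apply (B : C(K, E →L[ℝ] F)) (z : C(K, E)) (s : K) :
    pointwiseApply K E F B z s = B s (z s) := rfl

/-- The mean value inequality on a ball about each z(s) gives the remainder bound. The radius must
not depend on s; this comes from continuity of w ↦ dg ∘ w in the uniform norm. -/
theorem hasFDerivAt_superposition (g : C(E, F)) (dg : C(E, E →L[ℝ] F))
    (hg : ∀ x, HasFDerivAt g (dg x) x) (z : C(K, E)) :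
    HasFDerivAt (fun w : C(K, E) => g.comp w) (pointwiseApply K E F (dg.comp z)) z := by
  rw [hasFDerivAt_iff_isLittleO]
  rw [Asymptotics.isLittleO_iff]
  intro c hc
  have hcont := (ContinuousMap.continuous_postcomp (X := K) dg).continuousAt (x := z)
  obtain ⟨δ, hδ, hball⟩ := Metric.eventually_nhds_iff.1
    (hcont.eventually (Metric.ball_mem_nhds (dg.comp z) hc))
  filter_upwards [Metric.ball_mem_nhds z hδ] with w hw
  rw [ContinuousMap.norm_le _ (by positivity)]
  intro s
  have hws : w s ∈ Metric.ball (z s) δ :=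
    lt_of_le_of_lt (ContinuousMap.dist_apply_le_dist s) hw
  have hbound : ∀ x ∈ Metric.ball (z s) δ, ‖dg x - dg (z s)‖ ≤ c := by
    intro x hx
    -- The translate of z by the constant x - z(s) takes the value x at s, so continuity at z in
    -- C(K, E) bounds dg x - dg (z s).
    have h1 : dist (z + ContinuousMap.const K (x - z s)) z < δ := by
      rw [dist_eq_norm, add_sub_cancel_left]
      refine lt_of_le_of_lt ((ContinuousMap.norm_le _ (norm_nonneg _)).2 fun _ => le_rfl) ?_
      exact mem_ball_iff_norm.1 hx
    have h2 := (ContinuousMap.dist_apply_le_dist s).trans_lt (hball h1)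
    rw [dist_eq_norm] at h2
    simpa using h2.le
  have := (convex_ball (z s) δ).norm_image_sub_le_of_norm_hasFDerivWithin_le'
    (fun x _ => (hg x).hasFDerivWithinAt) hbound (Metric.mem_ball_self hδ) hws
  refine this.trans ?_
  gcongr
  exact (w - z).norm_coe_le_norm s

theorem contDiff_superposition (g : C(E, F)) (hg : ContDiff ℝ 1 g) :
    ContDiff ℝ 1 (fun w : C(K, E) => g.comp w) := by
  let dg : C(E, E →L[ℝ] F) := ⟨fderiv ℝ g, hg.continuous_fderiv one_ne_zero⟩
  rw [contDiff_one_iff_hasFDerivAt]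
  refine ⟨fun z => pointwiseApply K E F (dg.comp z),
    (pointwiseApply K E F).continuous.comp (ContinuousMap.continuous_postcomp dg), fun z => ?_⟩
  exact hasFDerivAt_superposition g dg
    (fun x => (hg.differentiable one_ne_zero x).hasFDerivAt) z

end Superposition

/-! ### Linear Volterra equations on [0,1]. -/

section Volterra

variable {E : Type*} [NormedAddCommGroup E] [NormedSpace ℝ E] [CompleteSpace E]

/-- Integration from `0`, as an operator on the continuous functions on the unit interval. -/
def volterra (E : Type*) [NormedAddCommGroup E] [NormedSpace ℝ E] [CompleteSpace E] :
    C(unitInterval, E) →L[ℝ] C(unitInterval, E) :=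
  LinearMap.mkContinuous
    { toFun := fun g => ⟨fun s => ∫ r in (0 : ℝ)..s, Set.IccExtend zero_le_one g r, by
        refine (intervalIntegral.continuous_primitive (fun a b => ?_) 0).comp continuous_subtype_val
        exact (g.continuous.Icc_extend' (h := zero_le_one)).intervalIntegrable a b⟩
      map_add' := fun g k => by
        ext s
        exact intervalIntegral.integral_add
          ((g.continuous.Icc_extend' (h := zero_le_one)).intervalIntegrable _ _)
          ((k.continuous.Icc_extend' (h := zero_le_one)).intervalIntegrable _ _)
      map_smul' := fun c g => by
        ext s
        exact intervalIntegral.integral_smul c _ } 1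
    (fun g => by
      rw [ContinuousMap.norm_le _ (by positivity)]
      intro s
      refine (intervalIntegral.norm_integral_le_of_norm_le_const
        (fun r _ => g.norm_coe_le_norm (Set.projIcc 0 1 zero_le_one r))).trans ?_
      rw [sub_zero, abs_of_nonneg s.2.1, one_mul]
      exact mul_le_of_le_one_right (norm_nonneg _) s.2.2)

theorem volterra_apply (g : C(unitInterval, E)) (s : unitInterval) :
    volterra E g s = ∫ r in (0 : ℝ)..s, Set.IccExtend zero_le_one g r := rfl

theorem volterra_eq_integral {g : C(unitInterval, E)} {k : ℝ → E}
    (h : ∀ s : unitInterval, g s = k s) (s : unitInterval) :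
    volterra E g s = ∫ r in (0 : ℝ)..s, k r := by
  rw [volterra_apply]
  refine intervalIntegral.integral_congr fun r hr => ?_
  rw [Set.uIcc_of_le s.2.1] at hr
  have hr' : r ∈ Set.Icc (0 : ℝ) 1 := ⟨hr.1, hr.2.trans s.2.2⟩
  rw [Set.IccExtend_of_mem _ _ hr', h]

/-- Restriction to the unit interval. -/
def onUnit {E : Type*} [TopologicalSpace E] (w : ℝ → E) (hw : Continuous w) : C(unitInterval, E) :=
  ⟨fun s => w s, hw.comp continuous_subtype_val⟩

@[simp]
theorem onUnit_apply {E : Type*} [TopologicalSpace E] (w : ℝ → E) (hw : Continuous w) (s : unitInterval) :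
    onUnit w hw s = w s := rfl

/-- The operator `ζ ↦ ζ - ∫₀ A ζ`. -/
def linearVolterra (A : C(unitInterval, E →L[ℝ] E)) :
    C(unitInterval, E) →L[ℝ] C(unitInterval, E) :=
  ContinuousLinearMap.id ℝ _ - (volterra E).comp (pointwiseApply unitInterval E E A)

theorem linearVolterra_apply (A : C(unitInterval, E →L[ℝ] E)) (z : C(unitInterval, E)) :
    linearVolterra A z = z - volterra E (pointwiseApply unitInterval E E A z) := rfl

/-- A solution of `w' = A w + b` satisfies `w - ∫₀ A w = w(0) + ∫₀ b`. -/
theorem linearVolterra_of_hasDerivAt {A : ℝ → E →L[ℝ] E} (hA : Continuous A)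
    {w b : ℝ → E} (hb : Continuous b) (hw : ∀ s, HasDerivAt w (A s (w s) + b s) s) :
    linearVolterra (onUnit A hA)
        (onUnit w (continuous_iff_continuousAt.2 fun s => (hw s).continuousAt)) =
      ContinuousMap.const _ (w 0) + volterra E (onUnit b hb) := by
  have hwc : Continuous w := continuous_iff_continuousAt.2 fun s => (hw s).continuousAt
  have hAw : Continuous fun s => A s (w s) := hA.clm_apply hwc
  ext s
  have h1 := intervalIntegral.integral_eq_sub_of_hasDerivAt (a := 0) (b := (s : ℝ))
    (fun r _ => hw r) ((hAw.add hb).intervalIntegrable _ _)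
  rw [intervalIntegral.integral_add (hAw.intervalIntegrable _ _) (hb.intervalIntegrable _ _)] at h1
  rw [linearVolterra_apply, ContinuousMap.sub_apply, ContinuousMap.add_apply,
    volterra_eq_integral (k := fun s => A s (w s)) (fun s => rfl),
    volterra_eq_integral (k := b) (fun s => rfl)]
  simp only [onUnit_apply, ContinuousMap.const_apply]
  rw [sub_eq_iff_eq_add, add_assoc, add_comm (∫ r in (0 : ℝ)..s, b r), h1]
  abel

/-- Here X is a fundamental solution and Y its inverse. A kernel element solves z' = Az with z(0) =
0, so Yz is constant and zero. Surjectivity is variation of constants. -/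
theorem linearVolterra_bijective {A X Y : ℝ → E →L[ℝ] E} (hA : Continuous A)
    (hX : ∀ s, HasDerivAt X ((A s).comp (X s)) s) (hY : ∀ s, HasDerivAt Y (-(Y s).comp (A s)) s)
    (hXY : ∀ s v, X s (Y s v) = v) :
    Function.Bijective (linearVolterra (onUnit A hA)) := by
  constructor
  · rw [injective_iff_map_eq_zero]
    intro z hz
    rw [linearVolterra_apply, sub_eq_zero] at hz
    set k : C(unitInterval, E) := pointwiseApply unitInterval E E (onUnit A hA) z with hk
    have hkc : Continuous (Set.IccExtend zero_le_one k) := k.continuous.Icc_extend'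
    let w : ℝ → E := fun s => ∫ r in (0 : ℝ)..s, Set.IccExtend zero_le_one k r
    have hw : ∀ s, HasDerivAt w (Set.IccExtend zero_le_one k s) s := fun s =>
      intervalIntegral.integral_hasDerivAt_right (hkc.intervalIntegrable _ _)
        (hkc.stronglyMeasurableAtFilter _ _) hkc.continuousAt
    have hzw : ∀ s : unitInterval, z s = w s := fun s => by
      conv_lhs => rw [hz]
      rfl
    have hYw : ∀ s ∈ Set.Icc (0 : ℝ) 1, HasDerivAt (fun s => Y s (w s)) 0 s := by
      intro s hs
      have := (hY s).clm_apply (hw s)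
      rw [Set.IccExtend_of_mem _ _ hs] at this
      have e : k ⟨s, hs⟩ = A s (w s) := by
        rw [hk, pointwiseApply_apply, hzw]
        rfl
      rw [e] at this
      simpa using this
    have hconst := constant_of_has_deriv_right_zero (f := fun s => Y s (w s)) (a := 0) (b := 1)
      (fun s hs => (hYw s hs).continuousAt.continuousWithinAt)
      (fun s hs => (hYw s ⟨hs.1, hs.2.le⟩).hasDerivWithinAt)
    ext s
    have h0 : w 0 = 0 := by simp [w]
    have := hconst s s.2
    simp only [h0, map_zero] at this
    rw [hzw, ← hXY s (w s), this]
    simp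
  · intro g
    let gx : ℝ → E := Set.IccExtend zero_le_one g
    have hgx : Continuous gx := g.continuous.Icc_extend'
    have hYc : Continuous Y := continuous_iff_continuousAt.2 fun s => (hY s).continuousAt
    have hi : Continuous fun s => Y s (A s (gx s)) := hYc.clm_apply (hA.clm_apply hgx)
    have hJ : ∀ s, HasDerivAt (fun s => ∫ r in (0 : ℝ)..s, Y r (A r (gx r)))
        (Y s (A s (gx s))) s := fun s =>
      intervalIntegral.integral_hasDerivAt_right (hi.intervalIntegrable _ _)
        (hi.stronglyMeasurableAtFilter _ _) hi.continuousAt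
    -- This w solves w' = Aw + Ag with w(0) = 0, so g + w is the preimage of g. Solving for w
    -- instead avoids differentiating g, which is only continuous.
    let w : ℝ → E := fun s => X s (∫ r in (0 : ℝ)..s, Y r (A r (gx r)))
    have hw : ∀ s, HasDerivAt w (A s (w s) + A s (gx s)) s := by
      intro s
      have := (hX s).clm_apply (hJ s)
      rw [hXY] at this
      exact this
    have hw0 : w 0 = 0 := by simp [w]
    refine ⟨g + onUnit w (continuous_iff_continuousAt.2 fun s => (hw s).continuousAt), ?_⟩
    rw [map_add, linearVolterra_of_hasDerivAt hA (hA.clm_apply hgx) hw, linearVolterra_apply, hw0]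
    have : pointwiseApply unitInterval E E (onUnit A hA) g =
        onUnit (fun s => A s (gx s)) (hA.clm_apply hgx) := by
      ext s
      simp [gx]
    rw [this]
    ext s
    simp

end Volterra

/-! ### From closed arcs to periodic solutions. -/

section PeriodicExtension

variable {E : Type*} [NormedAddCommGroup E] [NormedSpace ℝ E] [CompleteSpace E]

/-- A closed solution arc on the unit interval of an equation with `1`-periodic right-hand side
extends to a `1`-periodic solution on the line. -/
theorem exists_periodic_extension {g : ℝ → E → E} (hg : Continuous (Function.uncurry g))
    (hper : ∀ r x, g (r + 1) x = g r x) {z k : C(unitInterval, E)} {c : E}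
    (hk : ∀ s : unitInterval, k s = g s (z s))
    (hz : z = ContinuousMap.const _ c + volterra E k) (hz1 : z 1 = z 0) :
    ∃ Z : ℝ → E, Function.Periodic Z 1 ∧ Z 0 = c ∧ ∀ s, HasDerivAt Z (g s (Z s)) s := by
  let Z : ℝ → E := fun s => Set.IccExtend zero_le_one z (Int.fract s)
  have hzx : Continuous (Set.IccExtend zero_le_one z) := z.continuous.Icc_extend'
  have hZc : Continuous Z := by
    refine ContinuousOn.comp_fract'' hzx.continuousOn ?_
    rw [Set.IccExtend_left, Set.IccExtend_right]
    exact hz1.symm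
  have hZper : Function.Periodic Z 1 := fun s => by simp [Z]
  have hZz : ∀ s : unitInterval, Z s = z s := by
    intro s
    rcases eq_or_lt_of_le s.2.2 with h | h
    · have hs : s = 1 := Subtype.ext h
      subst hs
      have : (0 : ℝ) ∈ Set.Icc (0 : ℝ) 1 := by simp
      have e : Int.fract ((1 : unitInterval) : ℝ) = 0 := Int.fract_one
      simp only [Z]
      rw [e, Set.IccExtend_of_mem _ _ this, hz1]
      rfl
    · simp only [Z]
      rw [Int.fract_eq_self.2 ⟨s.2.1, h⟩, Set.IccExtend_val]
  let κ : ℝ → E := fun r => g r (Z r)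
  have hκ : Continuous κ := hg.comp (continuous_id.prodMk hZc)
  have hκper : Function.Periodic κ 1 := fun r => by simp only [κ]; rw [hZper, hper]
  have hint : ∀ s : unitInterval, Z s = c + ∫ r in (0 : ℝ)..s, κ r := by
    intro s
    rw [hZz]
    conv_lhs => rw [hz]
    rw [ContinuousMap.add_apply, volterra_eq_integral (k := κ) (fun r => by rw [hk, ← hZz])]
    rfl
  have hZ0 : Z 0 = c := by simpa using hint 0
  -- Closing of the arc means that κ has zero mean, so its primitive W is 1-periodic. Z agrees with
  -- W on [0,1], hence everywhere, and is thus differentiable at the integers too.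
  have hmean : ∫ r in (0 : ℝ)..1, κ r = 0 := by
    have h1 : Z 1 = c + ∫ r in (0 : ℝ)..1, κ r := hint 1
    rw [show (1 : ℝ) = 0 + 1 by norm_num, hZper, hZ0, zero_add] at h1
    simpa using h1
  let W : ℝ → E := fun s => c + ∫ r in (0 : ℝ)..s, κ r
  have hWper : Function.Periodic W 1 := by
    intro s
    simp only [W]
    rw [← intervalIntegral.integral_add_adjacent_intervals (hκ.intervalIntegrable 0 s)
      (hκ.intervalIntegrable s (s + 1)), hκper.intervalIntegral_add_eq s 0, zero_add, hmean,
      add_zero]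
  have hZW : Z = W := by
    funext s
    have e1 : Z s = Z (Int.fract s) := by simp [Z]
    have e2 : W s = W (Int.fract s) := by
      rw [Int.fract]
      simpa using (hWper.sub_int_mul_eq (x := s) ⌊s⌋).symm
    rw [e1, e2]
    exact hint ⟨Int.fract s, Int.fract_nonneg s, (Int.fract_lt_one s).le⟩
  refine ⟨Z, hZper, hZ0, fun s => ?_⟩
  have hd : HasDerivAt W (κ s) s :=
    (intervalIntegral.integral_hasDerivAt_right (hκ.intervalIntegrable _ _)
      (hκ.stronglyMeasurableAtFilter _ _) hκ.continuousAt).const_add c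
  rw [← hZW] at hd
  exact hd

end PeriodicExtension

/-! ### Determinants and multipliers in the plane. -/

section PlaneLinearAlgebra

theorem det_plane (L : (ℝ × ℝ) →ₗ[ℝ] (ℝ × ℝ)) :
    LinearMap.det L = (L (1, 0)).1 * (L (0, 1)).2 - (L (0, 1)).1 * (L (1, 0)).2 := by
  rw [← LinearMap.det_toMatrix (Module.Basis.finTwoProd ℝ), Matrix.det_fin_two]
  simp [LinearMap.toMatrix_apply]

open Polynomial in
theorem charpoly_plane (L : (ℝ × ℝ) →ₗ[ℝ] (ℝ × ℝ)) :
    L.charpoly = X ^ 2 - C ((L (1, 0)).1 + (L (0, 1)).2) * X + C (LinearMap.det L) := by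
  rw [← LinearMap.charpoly_toMatrix L (Module.Basis.finTwoProd ℝ), Matrix.charpoly_fin_two,
    LinearMap.det_toMatrix, Matrix.trace_fin_two]
  simp [LinearMap.toMatrix_apply]

open Polynomial in
theorem charpoly_roots_of_simple_one (L : (ℝ × ℝ) →ₗ[ℝ] (ℝ × ℝ))
    (h : L.charpoly.rootMultiplicity 1 = 1) :
    L.charpoly.roots = {1, LinearMap.det L} ∧ LinearMap.det L ≠ 1 := by
  have hroot : L.charpoly.IsRoot 1 := by
    have h0 : 0 < L.charpoly.rootMultiplicity 1 := by omega
    exact (rootMultiplicity_pos'.1 h0).2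
  have hfac : L.charpoly = (X - C 1) * (X - C (LinearMap.det L)) := by
    rw [charpoly_plane] at hroot ⊢
    simp only [IsRoot.def, eval_add, eval_sub, eval_mul, eval_pow, eval_X, eval_C] at hroot
    -- The characteristic polynomial vanishes at 1, which forces the trace to be 1 + det.
    have htr : (L (1, 0)).1 + (L (0, 1)).2 = 1 + LinearMap.det L := by linarith
    rw [htr, C_add, C_1]
    ring
  have hroots : L.charpoly.roots = {1, LinearMap.det L} := by
    rw [hfac, roots_mul (mul_ne_zero (X_sub_C_ne_zero _) (X_sub_C_ne_zero _)), roots_X_sub_C,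
      roots_X_sub_C]
    rfl
  refine ⟨hroots, fun hd => ?_⟩
  rw [← count_roots, hroots, hd] at h
  simp at h

theorem isUnit_of_det_ne_zero {L : (ℝ × ℝ) →L[ℝ] (ℝ × ℝ)}
    (h : LinearMap.det (L : (ℝ × ℝ) →ₗ[ℝ] (ℝ × ℝ)) ≠ 0) : IsUnit L := by
  rw [ContinuousLinearMap.isUnit_iff_bijective]
  exact (Module.End.isUnit_iff _).1
    ((LinearMap.isUnit_iff_isUnit_det _).2 (isUnit_iff_ne_zero.2 h))

end PlaneLinearAlgebra

/-! ### Liouville's formula and inverse fundamental solutions. -/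

/-- **Liouville's formula** for plane linear systems. -/
theorem liouville_formula {A Φ : ℝ → (ℝ × ℝ) →L[ℝ] (ℝ × ℝ)} (hA : Continuous A)
    (h0 : Φ 0 = ContinuousLinearMap.id ℝ (ℝ × ℝ))
    (hΦ : ∀ t, HasDerivAt Φ ((A t).comp (Φ t)) t) (t : ℝ) :
    LinearMap.det (Φ t : (ℝ × ℝ) →ₗ[ℝ] (ℝ × ℝ)) =
      Real.exp (∫ r in (0 : ℝ)..t, ((A r (1, 0)).1 + (A r (0, 1)).2)) := by
  let tr : ℝ → ℝ := fun r => (A r (1, 0)).1 + (A r (0, 1)).2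
  have htr : Continuous tr := by fun_prop
  let D : ℝ → ℝ := fun t => LinearMap.det (Φ t : (ℝ × ℝ) →ₗ[ℝ] (ℝ × ℝ))
  have hDdef : D = fun t => (Φ t (1, 0)).1 * (Φ t (0, 1)).2 - (Φ t (0, 1)).1 * (Φ t (1, 0)).2 :=
    funext fun t => det_plane _
  have hD : ∀ t, HasDerivAt D (tr t * D t) t := by
    intro t
    have hv : ∀ v, HasDerivAt (fun t => Φ t v) (A t (Φ t v)) t := fun v => by
      simpa using (hΦ t).clm_apply (hasDerivAt_const t v)
    have h1 : ∀ v, HasDerivAt (fun t => (Φ t v).1) (A t (Φ t v)).1 t := fun v =>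
      (ContinuousLinearMap.fst ℝ ℝ ℝ).hasFDerivAt.comp_hasDerivAt t (hv v)
    have h2 : ∀ v, HasDerivAt (fun t => (Φ t v).2) (A t (Φ t v)).2 t := fun v =>
      (ContinuousLinearMap.snd ℝ ℝ ℝ).hasFDerivAt.comp_hasDerivAt t (hv v)
    have hAv : ∀ v : ℝ × ℝ, A t v = v.1 • A t (1, 0) + v.2 • A t (0, 1) := fun v => by
      rw [← map_smul, ← map_smul, ← map_add]
      simp
    rw [hDdef]
    refine (((h1 (1, 0)).mul (h2 (0, 1))).sub ((h1 (0, 1)).mul (h2 (1, 0)))).congr_deriv ?_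
    rw [hAv (Φ t (1, 0)), hAv (Φ t (0, 1))]
    simp only [tr, Prod.fst_add, Prod.snd_add, Prod.smul_fst, Prod.smul_snd, smul_eq_mul]
    ring
  have hI : ∀ t, HasDerivAt (fun t => ∫ r in (0 : ℝ)..t, tr r) (tr t) t := fun t =>
    intervalIntegral.integral_hasDerivAt_right (htr.intervalIntegrable _ _)
      (htr.stronglyMeasurableAtFilter _ _) htr.continuousAt
  -- From D' = tr·D, the product of D with the integrating factor exp(-∫tr) is constant.
  have hE : ∀ t, HasDerivAt (fun t => D t * Real.exp (-∫ r in (0 : ℝ)..t, tr r)) 0 t := by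
    intro t
    refine ((hD t).mul (hI t).neg.exp).congr_deriv ?_
    ring
  have hconst := is_const_of_deriv_eq_zero (fun t => (hE t).differentiableAt)
    (fun t => (hE t).deriv) t 0
  have hD0 : D 0 = 1 := by
    rw [hDdef]
    simp [h0]
  simp only [hD0, intervalIntegral.integral_same, neg_zero, Real.exp_zero, mul_one] at hconst
  rw [Real.exp_neg, mul_inv_eq_one₀ (Real.exp_ne_zero _)] at hconst
  exact hconst

/-- The inverse of an invertible solution of `X' = A X` solves `Y' = - Y A`. -/
theorem hasDerivAt_inverse_of_linear {E : Type*} [NormedAddCommGroup E] [NormedSpace ℝ E]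
    [CompleteSpace E] {A X : ℝ → E →L[ℝ] E} {t : ℝ} (hu : IsUnit (X t))
    (hX : HasDerivAt X ((A t).comp (X t)) t) :
    HasDerivAt (fun t => Ring.inverse (X t)) (-(Ring.inverse (X t)).comp (A t)) t := by
  obtain ⟨u, hu⟩ := hu
  have h := hasFDerivAt_ringInverse (𝕜 := ℝ) u
  rw [hu] at h
  refine (h.comp_hasDerivAt t hX).congr_deriv ?_
  rw [← hu, Ring.inverse_unit]
  ext v
  have : ∀ w, (u : E →L[ℝ] E) ((↑u⁻¹ : E →L[ℝ] E) w) = w := fun w => by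
    rw [← mul_apply_eq_comp, Units.mul_inv]
    rfl
  simp [this]

/-! ### The plane vector field and its linearisation. -/

section PlaneField

variable {s : ℕ} {p : ℕ → ℝ → ℝ}

theorem contDiff_polyTerm (hp : ∀ k ≤ 2 * s + 1, ContDiff ℝ 1 (p k)) :
    ContDiff ℝ 1 fun x : ℝ × ℝ => polyTerm s p x.2 x.1 := by
  unfold polyTerm
  refine ContDiff.sum fun k hk => ?_
  have := hp k (by rw [mem_range] at hk; omega)
  fun_prop

theorem contDiff_planeField {F : ℝ → ℝ → ℝ} (hF : ContDiff ℝ 1 fun x : ℝ × ℝ => F x.2 x.1) :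
    ContDiff ℝ 1 (planeField F) :=
  hF.neg.prodMk contDiff_fst

theorem fderiv_planeField_snd {F : ℝ → ℝ → ℝ} (hF : ContDiff ℝ 1 fun x : ℝ × ℝ => F x.2 x.1)
    (x v : ℝ × ℝ) : (fderiv ℝ (planeField F) x v).2 = v.1 := by
  have h := ((contDiff_planeField hF).differentiable one_ne_zero x).hasFDerivAt.snd
  have h' : HasFDerivAt (fun x : ℝ × ℝ => x.1) (ContinuousLinearMap.fst ℝ ℝ ℝ) x := hasFDerivAt_fst
  have := h.unique h'
  exact congrArg (fun L => L v) this

theorem fderiv_planeField_polyTerm (hp : ∀ k ≤ 2 * s + 1, ContDiff ℝ 1 (p k)) (x : ℝ × ℝ) :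
    (fderiv ℝ (planeField (polyTerm s p)) x (1, 0)).1 =
      -∑ k ∈ Icc 1 (2 * s + 1), (k : ℝ) * p k x.2 * x.1 ^ (k - 1) := by
  have h := ((contDiff_planeField (contDiff_polyTerm hp)).differentiable one_ne_zero x).hasFDerivAt
  have hl : HasDerivAt (fun r : ℝ => (r, x.2)) ((1 : ℝ), (0 : ℝ)) x.1 :=
    (hasDerivAt_id x.1).prodMk (hasDerivAt_const x.1 x.2)
  have h1 := hasFDerivAt_fst.comp_hasDerivAt x.1 (HasFDerivAt.comp_hasDerivAt x.1 h hl)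
  have h2 : HasDerivAt (fun r : ℝ => -∑ k ∈ range (2 * s + 2), p k x.2 * r ^ k)
      (-∑ k ∈ range (2 * s + 2), p k x.2 * (k * x.1 ^ (k - 1))) x.1 :=
    (HasDerivAt.fun_sum fun k _ => (hasDerivAt_pow k x.1).const_mul _).neg
  have := h1.unique h2
  rw [show (fderiv ℝ (planeField (polyTerm s p)) x (1, 0)).1 = _ from this]
  congr 1
  -- The k = 0 term carries the factor k, so it drops out and the truncated exponent 0 - 1 plays no
  -- role.
  rw [Finset.range_eq_Ico, Finset.sum_eq_sum_Ico_succ_bot (by omega)]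
  simp only [Nat.cast_zero, zero_mul, mul_zero, zero_add]
  refine Finset.sum_congr ?_ fun k _ => by ring
  ext k
  simp only [mem_Ico, mem_Icc]
  omega

end PlaneField

/-! ### The closing operator and its derivative. -/

section ForcedField

variable {F : ℝ → ℝ → ℝ} {ω : ℝ → ℝ → ℝ → ℝ}

/-- The forced plane field in rescaled time, as a function of `(τ, ε, r, x)`: the period `τ`, the
amplitude `ε` of the forcing, its phase `r` and the state `x = (u', u)`. -/
def forcedField (F : ℝ → ℝ → ℝ) (ω : ℝ → ℝ → ℝ → ℝ) (w : ℝ × ℝ × ℝ × (ℝ × ℝ)) : ℝ × ℝ :=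
  w.1 • (planeField F w.2.2.2 + (w.2.1 * ω w.2.2.1 w.2.2.2.2 w.2.2.2.1, 0))

theorem contDiff_forcedField (hF : ContDiff ℝ 1 fun x : ℝ × ℝ => F x.2 x.1)
    (hω : ContDiff ℝ 1 (fun z : ℝ × ℝ × ℝ => ω z.1 z.2.1 z.2.2)) :
    ContDiff ℝ 1 (forcedField F ω) := by
  have h1 := (contDiff_planeField hF).comp
    (contDiff_snd.snd.snd : ContDiff ℝ 1 fun w : ℝ × ℝ × ℝ × (ℝ × ℝ) => w.2.2.2)
  have h2 := hω.comp (f := fun w : ℝ × ℝ × ℝ × (ℝ × ℝ) => (w.2.2.1, w.2.2.2.2, w.2.2.2.1))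
    (by fun_prop)
  simp only [Function.comp_def] at h1 h2
  exact contDiff_fst.smul (h1.add ((contDiff_snd.fst.mul h2).prodMk contDiff_const))

/-- The argument of `forcedField` along a curve `z` on the unit interval, for the parameters
`(ε, α)` and the unknowns `(z, (h, τ))`. -/
def forcedArgument (u : (ℝ × ℝ) × (C(unitInterval, ℝ × ℝ) × (ℝ × ℝ))) :
    C(unitInterval, ℝ × ℝ × ℝ × (ℝ × ℝ)) :=
  ContinuousLinearMap.const ℝ unitInterval (u.2.2.2, u.1.1, u.1.2 / u.2.2.2, (0 : ℝ × ℝ)) +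
    ContinuousLinearMap.compLeftContinuous ℝ unitInterval
      (ContinuousLinearMap.inr ℝ ℝ (ℝ × ℝ × (ℝ × ℝ)) ∘L
        ContinuousLinearMap.inr ℝ ℝ (ℝ × (ℝ × ℝ)) ∘L ContinuousLinearMap.inr ℝ ℝ (ℝ × ℝ)) u.2.1 +
    onUnit (fun s => (0, 0, s, 0)) (by fun_prop)

theorem forcedArgument_apply (u : (ℝ × ℝ) × (C(unitInterval, ℝ × ℝ) × (ℝ × ℝ)))
    (s : unitInterval) :
    forcedArgument u s = (u.2.2.2, u.1.1, u.1.2 / u.2.2.2 + s, u.2.1 s) := by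
  simp [forcedArgument]

theorem contDiffAt_forcedArgument {u : (ℝ × ℝ) × (C(unitInterval, ℝ × ℝ) × (ℝ × ℝ))}
    (hu : u.2.2.2 ≠ 0) : ContDiffAt ℝ 1 forcedArgument u := by
  have hdiv : ContDiffAt ℝ 1
      (fun u : (ℝ × ℝ) × (C(unitInterval, ℝ × ℝ) × (ℝ × ℝ)) => u.1.2 / u.2.2.2) u :=
    contDiffAt_fst.snd.div contDiffAt_snd.snd.snd hu
  have hpar : ContDiffAt ℝ 1 (fun u : (ℝ × ℝ) × (C(unitInterval, ℝ × ℝ) × (ℝ × ℝ)) =>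
      (u.2.2.2, u.1.1, u.1.2 / u.2.2.2, (0 : ℝ × ℝ))) u :=
    contDiffAt_snd.snd.snd.prodMk (contDiffAt_fst.fst.prodMk (hdiv.prodMk contDiffAt_const))
  unfold forcedArgument
  refine ContDiffAt.add (ContDiffAt.add ?_ ?_) contDiffAt_const
  · exact hpar.continuousLinearMap_comp _
  · exact contDiffAt_snd.fst.continuousLinearMap_comp _

/-- The operator whose zeros `((ε, α), (z, (h, τ)))` are the closed arcs `z` of the forced system
in rescaled time that start at `(0, a + h)`. -/
def closingOperator (a : ℝ) (H : C(ℝ × ℝ × ℝ × (ℝ × ℝ), ℝ × ℝ))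
    (u : (ℝ × ℝ) × (C(unitInterval, ℝ × ℝ) × (ℝ × ℝ))) : C(unitInterval, ℝ × ℝ) × (ℝ × ℝ) :=
  (u.2.1 - ContinuousLinearMap.const ℝ unitInterval ((0 : ℝ), a + u.2.2.1) -
      volterra (ℝ × ℝ) (H.comp (forcedArgument u)),
    ContinuousMap.evalCLM ℝ (1 : unitInterval) u.2.1 -
      ContinuousMap.evalCLM ℝ (0 : unitInterval) u.2.1)

theorem contDiffAt_closingOperator (a : ℝ) {H : C(ℝ × ℝ × ℝ × (ℝ × ℝ), ℝ × ℝ)}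
    (hH : ContDiff ℝ 1 H) {u : (ℝ × ℝ) × (C(unitInterval, ℝ × ℝ) × (ℝ × ℝ))}
    (hu : u.2.2.2 ≠ 0) : ContDiffAt ℝ 1 (closingOperator a H) u := by
  have h1 := (contDiff_superposition (K := unitInterval) H hH).contDiffAt.comp u
    (contDiffAt_forcedArgument hu)
  have h2 : ContDiffAt ℝ 1 (fun u : (ℝ × ℝ) × (C(unitInterval, ℝ × ℝ) × (ℝ × ℝ)) =>
      ((0 : ℝ), a + u.2.2.1)) u :=
    contDiffAt_const.prodMk (contDiffAt_const.add contDiffAt_snd.snd.fst)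
  refine ContDiffAt.prodMk ((contDiffAt_snd.fst.sub ?_).sub ?_) (ContDiffAt.sub ?_ ?_)
  · exact (ContinuousLinearMap.contDiff _).contDiffAt.comp u h2
  · exact (volterra (ℝ × ℝ)).contDiff.contDiffAt.comp u h1
  · exact (ContinuousLinearMap.contDiff _).contDiffAt.comp u contDiffAt_snd.fst
  · exact (ContinuousLinearMap.contDiff _).contDiffAt.comp u contDiffAt_snd.fst

/-- The partial derivative of `closingOperator` in the unknowns at an unforced arc `z₀`, where `A`
is the linearised field and `b` the field along `z₀`. -/
def closingDerivative (A : C(unitInterval, (ℝ × ℝ) →L[ℝ] (ℝ × ℝ))) (b : C(unitInterval, ℝ × ℝ)) :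
    C(unitInterval, ℝ × ℝ) × (ℝ × ℝ) →L[ℝ] C(unitInterval, ℝ × ℝ) × (ℝ × ℝ) :=
  (linearVolterra A ∘L ContinuousLinearMap.fst ℝ _ _ -
      ContinuousLinearMap.const ℝ unitInterval ∘L ContinuousLinearMap.inr ℝ ℝ ℝ ∘L
        ContinuousLinearMap.fst ℝ ℝ ℝ ∘L ContinuousLinearMap.snd ℝ _ _ -
      (ContinuousLinearMap.snd ℝ ℝ ℝ ∘L ContinuousLinearMap.snd ℝ _ _).smulRight
        (volterra (ℝ × ℝ) b)).prod
    (ContinuousMap.evalCLM ℝ (1 : unitInterval) ∘L ContinuousLinearMap.fst ℝ _ _ -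
      ContinuousMap.evalCLM ℝ (0 : unitInterval) ∘L ContinuousLinearMap.fst ℝ _ _)

theorem closingDerivative_apply (A : C(unitInterval, (ℝ × ℝ) →L[ℝ] (ℝ × ℝ)))
    (b : C(unitInterval, ℝ × ℝ)) (y : C(unitInterval, ℝ × ℝ) × (ℝ × ℝ)) :
    closingDerivative A b y =
      (linearVolterra A y.1 - ContinuousMap.const _ ((0 : ℝ), y.2.1) - y.2.2 • volterra (ℝ × ℝ) b,
        y.1 1 - y.1 0) := rfl

/-- With (ε, α) frozen at (0, 0) the forcing disappears, and the operator in the unknowns is built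
from z and τ f(z) alone. Uniqueness of the derivative then identifies the partial derivative,
without differentiating ω. -/
theorem fderiv_closingOperator_comp_inr (a : ℝ) (hF : ContDiff ℝ 1 fun x : ℝ × ℝ => F x.2 x.1)
    (hω : ContDiff ℝ 1 (fun z : ℝ × ℝ × ℝ => ω z.1 z.2.1 z.2.2))
    {H : C(ℝ × ℝ × ℝ × (ℝ × ℝ), ℝ × ℝ)} (hH : ∀ w, H w = forcedField F ω w)
    {z : C(unitInterval, ℝ × ℝ)} {η τ : ℝ} (hτ : τ ≠ 0)
    {A : C(unitInterval, (ℝ × ℝ) →L[ℝ] (ℝ × ℝ))}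
    (hA : ∀ s, A s = τ • fderiv ℝ (planeField F) (z s))
    {b : C(unitInterval, ℝ × ℝ)} (hb : ∀ s, b s = planeField F (z s)) :
    fderiv ℝ (closingOperator a H) (((0 : ℝ), (0 : ℝ)), (z, (η, τ))) ∘L
        ContinuousLinearMap.inr ℝ (ℝ × ℝ) (C(unitInterval, ℝ × ℝ) × (ℝ × ℝ)) =
      closingDerivative A b := by
  have hHc : ContDiff ℝ 1 H := by
    rw [show (H : ℝ × ℝ × ℝ × (ℝ × ℝ) → ℝ × ℝ) = forcedField F ω from funext hH]
    exact contDiff_forcedField hF hω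
  have hN := ((contDiffAt_closingOperator a hHc
    (u := (((0 : ℝ), (0 : ℝ)), (z, (η, τ)))) hτ).differentiableAt one_ne_zero).hasFDerivAt
  have hcomp := hN.comp (z, (η, τ)) (hasFDerivAt_prodMk_right ((0 : ℝ), (0 : ℝ)) (z, (η, τ)))
  have hf := contDiff_planeField hF
  let f : C(ℝ × ℝ, ℝ × ℝ) := ⟨planeField F, hf.continuous⟩
  let df : C(ℝ × ℝ, (ℝ × ℝ) →L[ℝ] (ℝ × ℝ)) :=
    ⟨fderiv ℝ (planeField F), hf.continuous_fderiv one_ne_zero⟩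
  have hsup := hasFDerivAt_superposition (K := unitInterval) f df
    (fun x => (hf.differentiable one_ne_zero x).hasFDerivAt) z
  have hsup' : HasFDerivAt (fun y : C(unitInterval, ℝ × ℝ) × (ℝ × ℝ) => f.comp y.1)
      (pointwiseApply unitInterval (ℝ × ℝ) (ℝ × ℝ) (df.comp z) ∘L ContinuousLinearMap.fst ℝ _ _)
      (z, (η, τ)) :=
    HasFDerivAt.comp (x := (z, (η, τ))) (f := Prod.fst) hsup hasFDerivAt_fst
  have hτ' : HasFDerivAt (fun y : C(unitInterval, ℝ × ℝ) × (ℝ × ℝ) => y.2.2)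
      (ContinuousLinearMap.snd ℝ ℝ ℝ ∘L ContinuousLinearMap.snd ℝ _ _) (z, (η, τ)) :=
    hasFDerivAt_snd.snd
  have hV := (volterra (ℝ × ℝ)).hasFDerivAt.comp (z, (η, τ)) (hτ'.smul hsup')
  have hη : HasFDerivAt (fun y : C(unitInterval, ℝ × ℝ) × (ℝ × ℝ) => ((0 : ℝ), a + y.2.1))
      (ContinuousLinearMap.inr ℝ ℝ ℝ ∘L ContinuousLinearMap.fst ℝ ℝ ℝ ∘L
        ContinuousLinearMap.snd ℝ _ _) (z, (η, τ)) := by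
    have := (ContinuousLinearMap.inr ℝ ℝ ℝ ∘L ContinuousLinearMap.fst ℝ ℝ ℝ ∘L
        ContinuousLinearMap.snd ℝ C(unitInterval, ℝ × ℝ) (ℝ × ℝ)).hasFDerivAt
          (x := (z, (η, τ))) |>.const_add ((0 : ℝ), a)
    refine this.congr_of_eventuallyEq (Eventually.of_forall fun y => ?_)
    simp
  have hC := (ContinuousLinearMap.const (M := ℝ × ℝ) ℝ unitInterval).hasFDerivAt.comp (z, (η, τ)) hη
  have hfst : HasFDerivAt (fun y : C(unitInterval, ℝ × ℝ) × (ℝ × ℝ) => y.1)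
      (ContinuousLinearMap.fst ℝ _ _) (z, (η, τ)) := hasFDerivAt_fst
  have he1 := (ContinuousMap.evalCLM ℝ (1 : unitInterval) ∘L
    ContinuousLinearMap.fst ℝ C(unitInterval, ℝ × ℝ) (ℝ × ℝ)).hasFDerivAt (x := (z, (η, τ)))
  have he0 := (ContinuousMap.evalCLM ℝ (0 : unitInterval) ∘L
    ContinuousLinearMap.fst ℝ C(unitInterval, ℝ × ℝ) (ℝ × ℝ)).hasFDerivAt (x := (z, (η, τ)))
  have hM := ((hfst.sub hC).sub hV).prodMk (he1.sub he0)
  refine (hcomp.unique (hM.congr_of_eventuallyEq (Eventually.of_forall fun y => ?_))).trans ?_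
  · refine Prod.ext ?_ rfl
    have : H.comp (forcedArgument (((0 : ℝ), (0 : ℝ)), y)) = y.2.2 • f.comp y.1 := by
      ext1 s
      rw [ContinuousMap.comp_apply, hH, forcedArgument_apply]
      simp [forcedField, f]
    simp only [Function.comp_apply, closingOperator, this]
    rfl
  · have hAz : A = τ • df.comp z := ContinuousMap.ext fun s => hA s
    have hbz : b = f.comp z := ContinuousMap.ext fun s => hb s
    refine ContinuousLinearMap.ext fun y => ?_
    rw [closingDerivative_apply, hAz, hbz, linearVolterra_apply]
    refine Prod.ext ?_ rfl
    simp only [ContinuousLinearMap.prod_apply, sub_apply, ContinuousLinearMap.comp_apply,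
      add_apply, smul_apply,
      ContinuousLinearMap.smulRight_apply, map_add, map_smul, ContinuousLinearMap.coe_fst',
      ContinuousLinearMap.coe_snd']
    change y.1 - _ - _ = _ - ContinuousLinearMap.const ℝ unitInterval ((0 : ℝ), y.2.1) - _
    simp only [ContinuousLinearMap.inr_apply]
    abel

end ForcedField

/-! ### Nondegeneracy at the periodic orbit. -/

/-- Subtracting the responses ζ₁ to the starting height and ζ₂ to the period eliminates the arc.
What remains is a 2×2 system for (η, σ), triangular by `hd₂'`: the second coordinate gives η, then
the first gives σ. -/
theorem closingDerivative_bijective {A : C(unitInterval, (ℝ × ℝ) →L[ℝ] (ℝ × ℝ))}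
    {b ζ₁ ζ₂ : C(unitInterval, ℝ × ℝ)} (hT : Function.Bijective (linearVolterra A))
    (h₁ : linearVolterra A ζ₁ = ContinuousMap.const _ ((0 : ℝ), (1 : ℝ)))
    (h₂ : linearVolterra A ζ₂ = volterra (ℝ × ℝ) b)
    (hd₁ : (ζ₁ 1 - ζ₁ 0).2 ≠ 0) (hd₂ : (ζ₂ 1 - ζ₂ 0).1 ≠ 0) (hd₂' : (ζ₂ 1 - ζ₂ 0).2 = 0) :
    Function.Bijective (closingDerivative A b) := by
  have hconst : ∀ η : ℝ, ContinuousMap.const unitInterval ((0 : ℝ), η) =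
      η • ContinuousMap.const unitInterval ((0 : ℝ), (1 : ℝ)) := fun η => by
    ext s <;> simp
  have key : ∀ (ζ : C(unitInterval, ℝ × ℝ)) (η σ : ℝ),
      closingDerivative A b (ζ + η • ζ₁ + σ • ζ₂, (η, σ)) =
        (linearVolterra A ζ, ζ 1 - ζ 0 + η • (ζ₁ 1 - ζ₁ 0) + σ • (ζ₂ 1 - ζ₂ 0)) := by
    intro ζ η σ
    rw [closingDerivative_apply]
    refine Prod.ext ?_ ?_
    · simp only [map_add, map_smul, h₁, h₂]
      rw [hconst η]
      abel
    · simp only [ContinuousMap.add_apply, ContinuousMap.smul_apply, smul_sub]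
      abel
  constructor
  · rw [injective_iff_map_eq_zero]
    rintro ⟨ζ, η, σ⟩ h
    have hζ : ζ = (ζ - η • ζ₁ - σ • ζ₂) + η • ζ₁ + σ • ζ₂ := by abel
    rw [hζ, key, Prod.mk_eq_zero] at h
    have h0 : ζ - η • ζ₁ - σ • ζ₂ = 0 := (injective_iff_map_eq_zero _).1 hT.1 _ h.1
    have hb := h.2
    rw [h0] at hb
    have hb2 := congrArg Prod.snd hb
    have hb1 := congrArg Prod.fst hb
    simp only [ContinuousMap.zero_apply, sub_zero, zero_add, Prod.snd_add, Prod.smul_snd, hd₂',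
      mul_zero, add_zero, Prod.snd_zero, smul_eq_mul, mul_eq_zero, hd₁, or_false] at hb2
    subst hb2
    simp only [ContinuousMap.zero_apply, sub_zero, zero_add, zero_smul, Prod.smul_fst,
      Prod.fst_zero, smul_eq_mul, mul_eq_zero, hd₂, or_false] at hb1
    subst hb1
    rw [hζ, h0]
    simp
  · rintro ⟨g, d⟩
    obtain ⟨ζ, rfl⟩ := hT.2 g
    let η := (d - (ζ 1 - ζ 0)).2 / (ζ₁ 1 - ζ₁ 0).2
    let σ := ((d - (ζ 1 - ζ 0)).1 - η * (ζ₁ 1 - ζ₁ 0).1) / (ζ₂ 1 - ζ₂ 0).1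
    have hη : η * (ζ₁ 1 - ζ₁ 0).2 = (d - (ζ 1 - ζ 0)).2 := div_mul_cancel₀ _ hd₁
    have hσ : σ * (ζ₂ 1 - ζ₂ 0).1 = (d - (ζ 1 - ζ 0)).1 - η * (ζ₁ 1 - ζ₁ 0).1 :=
      div_mul_cancel₀ _ hd₂
    refine ⟨(ζ + η • ζ₁ + σ • ζ₂, (η, σ)), ?_⟩
    rw [key]
    refine Prod.ext rfl (Prod.ext ?_ ?_)
    · simp only [Prod.fst_add, Prod.smul_fst, smul_eq_mul, hσ]
      simp only [Prod.fst_sub]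
      ring
    · simp only [Prod.snd_add, Prod.smul_snd, smul_eq_mul, hη, hd₂']
      simp only [Prod.snd_sub]
      ring

section PeriodicOrbit

variable {F : ℝ → ℝ → ℝ} {q : ℝ → ℝ × ℝ} {Φ : ℝ → (ℝ × ℝ) →L[ℝ] (ℝ × ℝ)} {τ₀ : ℝ}

theorem isUnit_of_isFundamental (hF : ContDiff ℝ 1 fun x : ℝ × ℝ => F x.2 x.1)
    (hq : ∀ t, HasDerivAt q (planeField F (q t)) t) (hΦ : IsFundamental (planeField F) q Φ) (t : ℝ) :
    IsUnit (Φ t) := by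
  have hqc : Continuous q := continuous_iff_continuousAt.2 fun t => (hq t).continuousAt
  have hA : Continuous fun t => fderiv ℝ (planeField F) (q t) :=
    ((contDiff_planeField hF).continuous_fderiv one_ne_zero).comp hqc
  refine isUnit_of_det_ne_zero ?_
  rw [liouville_formula hA hΦ.1 hΦ.2]
  exact Real.exp_ne_zero _

theorem inverse_apply_cancel {X : (ℝ × ℝ) →L[ℝ] (ℝ × ℝ)} (hX : IsUnit X) (v : ℝ × ℝ) :
    X (Ring.inverse X v) = v := by
  rw [← mul_apply_eq_comp, Ring.mul_inverse_cancel _ hX]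
  rfl

theorem hasDerivAt_velocity (hF : ContDiff ℝ 1 fun x : ℝ × ℝ => F x.2 x.1)
    (hq : ∀ t, HasDerivAt q (planeField F (q t)) t) (t : ℝ) :
    HasDerivAt (fun t => planeField F (q t))
      (fderiv ℝ (planeField F) (q t) (planeField F (q t))) t :=
  HasFDerivAt.comp_hasDerivAt t
    ((contDiff_planeField hF).differentiable one_ne_zero (q t)).hasFDerivAt (hq t)

/-- The velocity of an orbit is transported by the fundamental solution. -/
theorem fundamental_velocity (hF : ContDiff ℝ 1 fun x : ℝ × ℝ => F x.2 x.1)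
    (hq : ∀ t, HasDerivAt q (planeField F (q t)) t) (hΦ : IsFundamental (planeField F) q Φ) (t : ℝ) :
    Φ t (planeField F (q 0)) = planeField F (q t) := by
  have hu := isUnit_of_isFundamental hF hq hΦ
  have hd : ∀ t, HasDerivAt (fun t => Ring.inverse (Φ t) (planeField F (q t))) 0 t := fun t =>
    ((hasDerivAt_inverse_of_linear (A := fun t => fderiv ℝ (planeField F) (q t)) (hu t)
      (hΦ.2 t)).clm_apply (hasDerivAt_velocity hF hq t)).congr_deriv (by simp)
  have hc := is_const_of_deriv_eq_zero (fun t => (hd t).differentiableAt) (fun t => (hd t).deriv) t 0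
  have h0 : Ring.inverse (Φ 0) = 1 := by
    rw [hΦ.1]
    exact Ring.inverse_one _
  simp only [h0, one_apply_eq_self] at hc
  rw [← hc, inverse_apply_cancel (hu t)]

/-- The return condition of a periodic orbit through `(0, a)` whose nontrivial multiplier is not `1`
is nondegenerate in the amplitude and the period. -/
theorem closingDerivative_bijective_of_periodicOrbit
    (hF : ContDiff ℝ 1 fun x : ℝ × ℝ => F x.2 x.1)
    (hq : ∀ t, HasDerivAt q (planeField F (q t)) t) (hΦ : IsFundamental (planeField F) q Φ)
    (hper : q τ₀ = q 0) (hq0 : (q 0).1 = 0) (hF0 : F (q 0).2 0 ≠ 0)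
    (hdet : LinearMap.det (Φ τ₀ : (ℝ × ℝ) →ₗ[ℝ] (ℝ × ℝ)) ≠ 1)
    {A : C(unitInterval, (ℝ × ℝ) →L[ℝ] (ℝ × ℝ))}
    (hA : ∀ s, A s = τ₀ • fderiv ℝ (planeField F) (q (τ₀ * s)))
    {b : C(unitInterval, ℝ × ℝ)} (hb : ∀ s, b s = planeField F (q (τ₀ * s))) :
    Function.Bijective (closingDerivative A b) := by
  have hf := contDiff_planeField hF
  have hqc : Continuous q := continuous_iff_continuousAt.2 fun t => (hq t).continuousAt
  have hmul : Continuous fun s : ℝ => τ₀ * s := continuous_const_mul τ₀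
  have hmul' : ∀ s : ℝ, HasDerivAt (fun s : ℝ => τ₀ * s) τ₀ s := fun s => by
    simpa using (hasDerivAt_id s).const_mul τ₀
  let B : ℝ → (ℝ × ℝ) →L[ℝ] (ℝ × ℝ) := fun s => τ₀ • fderiv ℝ (planeField F) (q (τ₀ * s))
  have hB : Continuous B :=
    ((hf.continuous_fderiv one_ne_zero).comp (hqc.comp hmul)).const_smul τ₀
  have hAB : A = onUnit B hB := ContinuousMap.ext hA
  have hbc : Continuous fun s => planeField F (q (τ₀ * s)) := hf.continuous.comp (hqc.comp hmul)
  have hbb : b = onUnit (fun s => planeField F (q (τ₀ * s))) hbc := ContinuousMap.ext hb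
  have hu := isUnit_of_isFundamental hF hq hΦ
  have hX : ∀ s, HasDerivAt (fun s => Φ (τ₀ * s)) ((B s).comp (Φ (τ₀ * s))) s := fun s =>
    ((hΦ.2 (τ₀ * s)).scomp s (hmul' s)).congr_deriv
      (ContinuousLinearMap.smul_comp _ _ _).symm
  have hw₁ : ∀ s, HasDerivAt (fun s => Φ (τ₀ * s) (0, 1)) (B s (Φ (τ₀ * s) (0, 1)) + 0) s :=
    fun s => ((hX s).clm_apply (hasDerivAt_const s ((0 : ℝ), (1 : ℝ)))).congr_deriv (by simp)
  -- A change of period shifts the rescaled orbit along its velocity by an amount proportional to s.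
  -- This is ζ₂, whose endpoint difference is f(q(τ₀)).
  have hw₂ : ∀ s, HasDerivAt (fun s => s • planeField F (q (τ₀ * s)))
      (B s (s • planeField F (q (τ₀ * s))) + planeField F (q (τ₀ * s))) s := fun s =>
    ((hasDerivAt_id s).smul ((hasDerivAt_velocity hF hq (τ₀ * s)).scomp s (hmul' s))).congr_deriv
      (by simp [B])
  have hΦe : Φ τ₀ (1, 0) = (1, 0) := by
    have h := fundamental_velocity hF hq hΦ τ₀
    have hv : planeField F (q 0) = (-F (q 0).2 0) • ((1 : ℝ), (0 : ℝ)) := by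
      simp [planeField, hq0]
    rw [hper, hv, map_smul] at h
    exact smul_right_injective (ℝ × ℝ) (neg_ne_zero.2 hF0) h
  have hT : Function.Bijective (linearVolterra A) := by
    rw [hAB]
    exact linearVolterra_bijective hB hX
      (fun s => hasDerivAt_inverse_of_linear (hu _) (hX s))
      (fun s v => inverse_apply_cancel (hu _) v)
  have h₁ := linearVolterra_of_hasDerivAt hB continuous_const hw₁
  have h₂ := linearVolterra_of_hasDerivAt hB hbc hw₂
  rw [← hAB] at h₁ h₂
  refine closingDerivative_bijective hT (h₁.trans ?_) (h₂.trans ?_) ?_ ?_ ?_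
  · have hz : onUnit (fun _ : ℝ => (0 : ℝ × ℝ)) continuous_const = 0 := rfl
    rw [hz, map_zero, add_zero, mul_zero, hΦ.1]
    rfl
  · rw [zero_smul, hbb]
    exact zero_add _
  -- As Φ(τ₀)e₁ = e₁, the lower right entry of Φ(τ₀) is its determinant, so this difference is det -
  -- 1.
  · simp only [onUnit_apply, Set.Icc.coe_one, Set.Icc.coe_zero, mul_one, mul_zero, hΦ.1]
    rw [det_plane] at hdet
    simp only [ContinuousLinearMap.coe_coe, hΦe] at hdet
    simpa [sub_eq_zero] using hdet
  · simpa [hper, planeField, hq0] using hF0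
  · simp [hper, planeField, hq0]

end PeriodicOrbit

/-! ### Persistence under forcing. -/

/-- A nondegenerate periodic orbit of `u'' + F(u, u') = 0` persists under small periodic forcing
whose period is adjusted to the amplitude `ε` and the phase `α`. -/
theorem exists_controllably_periodic {F : ℝ → ℝ → ℝ} {ω : ℝ → ℝ → ℝ → ℝ} {q : ℝ → ℝ × ℝ}
    {Φ : ℝ → (ℝ × ℝ) →L[ℝ] (ℝ × ℝ)} {τ₀ a : ℝ}
    (hF : ContDiff ℝ 1 fun x : ℝ × ℝ => F x.2 x.1)
    (hω : ContDiff ℝ 1 (fun z : ℝ × ℝ × ℝ => ω z.1 z.2.1 z.2.2))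
    (hω_per : ∀ r x y : ℝ, ω (r + 1) x y = ω r x y)
    (hq : ∀ t, HasDerivAt q (planeField F (q t)) t) (hΦ : IsFundamental (planeField F) q Φ)
    (hτ₀ : 0 < τ₀) (hper : q τ₀ = q 0) (hq0 : q 0 = (0, a)) (hF0 : F a 0 ≠ 0)
    (hdet : LinearMap.det (Φ τ₀ : (ℝ × ℝ) →ₗ[ℝ] (ℝ × ℝ)) ≠ 1) :
    ∃ (U : Set (ℝ × ℝ)) (τ h : ℝ × ℝ → ℝ) (τ₁ : ℝ),
      IsOpen U ∧ ((0 : ℝ), (0 : ℝ)) ∈ U ∧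
      ContDiffOn ℝ 1 τ U ∧ ContDiffOn ℝ 1 h U ∧
      0 < τ₁ ∧ τ₁ < τ₀ ∧ τ (0, 0) = τ₀ ∧ h (0, 0) = 0 ∧
      ∀ ε α : ℝ, (ε, α) ∈ U →
        |τ (ε, α) - τ₀| < τ₁ ∧
        ∃ ν : ℝ → ℝ,
          IsSolution F (fun t x y => ε * ω (t / τ (ε, α)) x y) ν ∧
          ν α = a + h (ε, α) ∧ deriv ν α = 0 ∧
          Function.Periodic ν (τ (ε, α)) := by
  have hf := contDiff_planeField hF
  have hqc : Continuous q := continuous_iff_continuousAt.2 fun t => (hq t).continuousAt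
  have hmul : Continuous fun s : ℝ => τ₀ * s := continuous_const_mul τ₀
  have hHc := contDiff_forcedField hF hω
  let H : C(ℝ × ℝ × ℝ × (ℝ × ℝ), ℝ × ℝ) := ⟨forcedField F ω, hHc.continuous⟩
  let z₀ : C(unitInterval, ℝ × ℝ) := onUnit (fun s => q (τ₀ * s)) (hqc.comp hmul)
  let A : C(unitInterval, (ℝ × ℝ) →L[ℝ] (ℝ × ℝ)) :=
    onUnit (fun s => τ₀ • fderiv ℝ (planeField F) (q (τ₀ * s)))
      (((hf.continuous_fderiv one_ne_zero).comp (hqc.comp hmul)).const_smul τ₀)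
  let b : C(unitInterval, ℝ × ℝ) :=
    onUnit (fun s => planeField F (q (τ₀ * s))) (hf.continuous.comp (hqc.comp hmul))
  let u : (ℝ × ℝ) × (C(unitInterval, ℝ × ℝ) × (ℝ × ℝ)) := ((0, 0), (z₀, (0, τ₀)))
  have hN : ContDiffAt ℝ 1 (closingOperator a H) u := contDiffAt_closingOperator a hHc hτ₀.ne'
  have hN0 : closingOperator a H u = 0 := by
    have hmul' : ∀ s : ℝ, HasDerivAt (fun s : ℝ => τ₀ * s) τ₀ s := fun s => by
      simpa using (hasDerivAt_id s).const_mul τ₀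
    have hz : ∀ s : ℝ, HasDerivAt (fun s => q (τ₀ * s)) (τ₀ • planeField F (q (τ₀ * s))) s :=
      fun s => (hq (τ₀ * s)).scomp s (hmul' s)
    refine Prod.ext ?_ ?_
    · refine ContinuousMap.ext fun s => ?_
      have hs : volterra (ℝ × ℝ) (H.comp (forcedArgument u)) s = q (τ₀ * s) - q (τ₀ * 0) := by
        rw [volterra_eq_integral (k := fun s => τ₀ • planeField F (q (τ₀ * s)))]
        · exact intervalIntegral.integral_eq_sub_of_hasDerivAt (fun r _ => hz r)
            (((hf.continuous.comp (hqc.comp hmul)).const_smul τ₀).intervalIntegrable _ _)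
        · intro r
          rw [ContinuousMap.comp_apply, forcedArgument_apply]
          simp [H, forcedField, u, z₀]
      simp only [closingOperator, ContinuousMap.sub_apply, hs]
      simp [u, z₀, hq0]
    · simp [closingOperator, u, z₀, hper]
  have hinv : (fderiv ℝ (closingOperator a H) u ∘L
      ContinuousLinearMap.inr ℝ (ℝ × ℝ) (C(unitInterval, ℝ × ℝ) × (ℝ × ℝ))).IsInvertible := by
    rw [fderiv_closingOperator_comp_inr a hF hω (fun _ => rfl) hτ₀.ne' (A := A) (fun _ => rfl)
      (b := b) (fun _ => rfl)]
    have hbij : Function.Bijective (closingDerivative A b) :=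
      closingDerivative_bijective_of_periodicOrbit hF hq hΦ hper (by rw [hq0])
        (by rwa [hq0]) hdet (fun _ => rfl) (fun _ => rfl)
    exact ⟨ContinuousLinearEquiv.ofBijective _ (LinearMap.ker_eq_bot.2 hbij.1)
      (LinearMap.range_eq_top.2 hbij.2), ContinuousLinearEquiv.coe_ofBijective _ _ _⟩
  let ψ := hN.implicitFunction one_ne_zero hinv
  have hψ0 : ψ (0, 0) = (z₀, (0, τ₀)) := hN.implicitFunction_apply_self one_ne_zero hinv
  have hψz : ∀ᶠ x in nhds ((0 : ℝ), (0 : ℝ)), closingOperator a H (x, ψ x) = 0 := by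
    rw [← hN0]
    exact hN.eventually_apply_implicitFunction one_ne_zero hinv
  have hψc : ContDiffAt ℝ 1 ψ (0, 0) := hN.contDiffAt_implicitFunction one_ne_zero hinv
  -- The radius τ₀/2 serves as τ₁ and keeps the new period positive, so that time can be rescaled
  -- back.
  have hτ : ∀ᶠ x in nhds ((0 : ℝ), (0 : ℝ)), |(ψ x).2.2 - τ₀| < τ₀ / 2 := by
    have hc : ContinuousAt (fun x => (ψ x).2.2) (0, 0) := hψc.continuousAt.snd.snd
    have := Metric.continuousAt_iff'.1 hc (τ₀ / 2) (half_pos hτ₀)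
    simpa only [hψ0, Real.dist_eq] using this
  obtain ⟨V, hVn, hVc⟩ := hψc.contDiffOn le_rfl (by simp)
  obtain ⟨U, hU, hUo, hU0⟩ := eventually_nhds_iff.1 ((hψz.and hτ).and (eventually_mem_set.2 hVn))
  have hψU : ContDiffOn ℝ 1 ψ U := hVc.mono fun x hx => (hU x hx).2
  refine ⟨U, fun x => (ψ x).2.2, fun x => (ψ x).2.1, τ₀ / 2, hUo, hU0, hψU.snd.snd, hψU.snd.fst,
    half_pos hτ₀, half_lt_self hτ₀, by simp [hψ0], by simp [hψ0], fun ε α hεα => ?_⟩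
  obtain ⟨⟨hzero, hclose⟩, -⟩ := hU _ hεα
  refine ⟨hclose, ?_⟩
  have hT : 0 < (ψ (ε, α)).2.2 := by
    have := (abs_lt.1 hclose).1
    linarith
  beta_reduce
  generalize ψ (ε, α) = y at hzero hT ⊢
  obtain ⟨z, η, T⟩ := y
  simp only at hT ⊢
  have hz := congrArg Prod.fst hzero
  have hz' := congrArg Prod.snd hzero
  simp only [closingOperator, Prod.fst_zero, Prod.snd_zero, sub_eq_zero,
    ContinuousMap.evalCLM_apply] at hz hz'
  rw [sub_eq_iff_eq_add'] at hz
  let g : ℝ → ℝ × ℝ → ℝ × ℝ := fun s x => forcedField F ω (T, ε, α / T + s, x)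
  have hg : Continuous (Function.uncurry g) := hHc.continuous.comp (by fun_prop)
  obtain ⟨Z, hZper, hZ0, hZ⟩ := exists_periodic_extension hg
    (fun r x => by simp only [g, forcedField, ← add_assoc, hω_per])
    (fun s => by rw [ContinuousMap.comp_apply, forcedArgument_apply]; rfl) hz hz'
  -- Back to real time via s = (t - α)/T: the factor T⁻¹ cancels the T in the field, and the phase
  -- α/T + s becomes t/T.
  have hlin : ∀ t : ℝ, HasDerivAt (fun t => (t - α) / T) T⁻¹ t := fun t => by
    simpa using ((hasDerivAt_id t).sub_const α).div_const T
  have hx : ∀ t : ℝ, HasDerivAt (fun t => Z ((t - α) / T))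
      (planeField F (Z ((t - α) / T)) +
        (ε * ω (t / T) (Z ((t - α) / T)).2 (Z ((t - α) / T)).1, 0)) t := fun t => by
    refine ((hZ _).scomp t (hlin t)).congr_deriv ?_
    simp only [g, forcedField]
    rw [inv_smul_smul₀ hT.ne', ← add_div, add_sub_cancel]
  have hν : ∀ t, HasDerivAt (fun t => (Z ((t - α) / T)).2) (Z ((t - α) / T)).1 t := fun t =>
    ((ContinuousLinearMap.snd ℝ ℝ ℝ).hasFDerivAt.comp_hasDerivAt t (hx t)).congr_deriv
      (by simp [planeField])
  have hdν : deriv (fun t => (Z ((t - α) / T)).2) = fun t => (Z ((t - α) / T)).1 :=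
    funext fun t => (hν t).deriv
  refine ⟨fun t => (Z ((t - α) / T)).2, ⟨fun t => (hν t).differentiableAt, fun t => ?_⟩, ?_, ?_, ?_⟩
  · rw [hdν]
    refine ((ContinuousLinearMap.fst ℝ ℝ ℝ).hasFDerivAt.comp_hasDerivAt t (hx t)).congr_deriv ?_
    simp [planeField]
    ring
  · simp [hZ0]
  · rw [hdν]
    simp [hZ0]
  · intro t
    have : (t + T - α) / T = (t - α) / T + 1 := by
      field_simp
      ring
    simp only [this, hZper ((t - α) / T)]

end Lienard
end

/-! ### The main theorem. -/

theorem theorem2 (s : ℕ) (p : ℕ → ℝ → ℝ)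
    (hp : ∀ k ≤ 2 * s + 1, ContDiff ℝ 1 (p k))
    (hLS : Lienard.LevinsonSmith (Lienard.damping s p) (p 0))
    (ω : ℝ → ℝ → ℝ → ℝ)
    (hω : ContDiff ℝ 1 (fun z : ℝ × ℝ × ℝ => ω z.1 z.2.1 z.2.2))
    (hω_per : ∀ r x y : ℝ, ω (r + 1) x y = ω r x y)
    (u₀ : ℝ → ℝ) (τ₀ a : ℝ)
    (hu₀ : Lienard.IsSolution (Lienard.polyTerm s p) (fun _ _ _ => 0) u₀)
    (hτ₀ : IsLeast {T : ℝ | 0 < T ∧ Function.Periodic u₀ T} τ₀)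
    (ha : u₀ 0 = a) (ha_neg : a < 0) (hu₀' : deriv u₀ 0 = 0)
    (Φ : ℝ → (ℝ × ℝ) →L[ℝ] (ℝ × ℝ))
    (hΦ : Lienard.IsFundamental (Lienard.planeField (Lienard.polyTerm s p))
      (fun t => (deriv u₀ t, u₀ t)) Φ)
    (hsimple : (Lienard.multiplierPoly Φ τ₀).rootMultiplicity 1 = 1) :
    (Lienard.multiplierPoly Φ τ₀).roots =
      {1, Real.exp (-∫ t in (0 : ℝ)..τ₀,
        ∑ k ∈ Finset.Icc 1 (2 * s + 1), (k : ℝ) * p k (u₀ t) * deriv u₀ t ^ (k - 1))} ∧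
    ∃ (U : Set (ℝ × ℝ)) (τ h : ℝ × ℝ → ℝ) (τ₁ : ℝ),
      IsOpen U ∧ ((0 : ℝ), (0 : ℝ)) ∈ U ∧
      ContDiffOn ℝ 1 τ U ∧ ContDiffOn ℝ 1 h U ∧
      0 < τ₁ ∧ τ₁ < τ₀ ∧ τ (0, 0) = τ₀ ∧ h (0, 0) = 0 ∧
      ∀ ε α : ℝ, (ε, α) ∈ U →
        |τ (ε, α) - τ₀| < τ₁ ∧
        ∃ ν : ℝ → ℝ,
          Lienard.IsSolution (Lienard.polyTerm s p)
            (fun t x y => ε * ω (t / τ (ε, α)) x y) ν ∧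
          ν α = a + h (ε, α) ∧ deriv ν α = 0 ∧
          Function.Periodic ν (τ (ε, α)) := by
  have hF := Lienard.contDiff_polyTerm hp
  have hf := Lienard.contDiff_planeField hF
  have hq : ∀ t, HasDerivAt (fun t => (deriv u₀ t, u₀ t))
      (Lienard.planeField (Lienard.polyTerm s p) (deriv u₀ t, u₀ t)) t := fun t =>
    ((hu₀.2 t).prodMk (hu₀.1 t).hasDerivAt).congr_deriv (by simp [Lienard.planeField])
  have hqc : Continuous fun t => (deriv u₀ t, u₀ t) :=
    continuous_iff_continuousAt.2 fun t => (hq t).continuousAt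
  obtain ⟨hroots, hdet⟩ := Lienard.charpoly_roots_of_simple_one _ hsimple
  refine ⟨?_, ?_⟩
  · refine hroots.trans ?_
    rw [Lienard.liouville_formula ((hf.continuous_fderiv one_ne_zero).comp hqc) hΦ.1 hΦ.2,
      ← intervalIntegral.integral_neg]
    -- The second row of f' is (1, 0), so only the damping entry contributes to the trace.
    simp only [Function.comp_apply, Lienard.fderiv_planeField_polyTerm hp,
      Lienard.fderiv_planeField_snd hF, add_zero]
  · have hper : deriv u₀ τ₀ = deriv u₀ 0 ∧ u₀ τ₀ = u₀ 0 := by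
      refine ⟨?_, by simpa using hτ₀.1.2 0⟩
      have h := deriv_comp_add_const u₀ τ₀ 0
      rw [show (fun x => u₀ (x + τ₀)) = u₀ from funext hτ₀.1.2, zero_add] at h
      exact h.symm
    refine Lienard.exists_controllably_periodic hF hω hω_per hq hΦ hτ₀.1.1
      (Prod.ext hper.1 hper.2) (Prod.ext hu₀' ha) ?_ hdet
    -- At zero velocity the polynomial term reduces to p₀(a), nonzero because a·p₀(a) > 0.
    have hψ := hLS.1 a (abs_pos.2 ha_neg.ne)
    rw [Lienard.polyTerm, Finset.sum_range_succ']
    simp only [pow_succ, mul_zero, Finset.sum_const_zero, zero_add, pow_zero, mul_one]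
    exact right_ne_zero_of_mul hψ.ne'
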